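/- Let $\Gamma$ be a directed graph on $n$ nodes without parallel arcs. Each pair $(u,v)$ of nodes carries a weight interval $[\lambda_{uv},\mu_{uv}]$ with $0\le\lambda_{uv}\le\mu_{uv}\le\infty$, where $\lambda_{uv}=\mu_{uv}=\infty$ means that the arc $(u,v)$ is absent, and $\lambda_{uv}=\mu_{uv}<\infty$ that it has constant weight. Let $k$ be the number of pairs with $\lambda_{uv}<\mu_{uv}$; each of these arcs has a variable $x_{uv}$ of its own as its weight. Let $D\in\mathbb T[x_1,\dots,x_k]^{n\times n}$ be the weighted adjacency matrix with entries $d_{uv}=x_{uv}$ if $\lambda_{uv}<\mu_{uv}$ and $d_{uv}=\lambda_{uv}$ otherwise, over the polynomials with coefficients in the tropical semiring $\mathbb T=(\mathbb R\cup\{\infty\},\min,+)$, and let $D^*=(I\oplus D)^{\odot(n-1)}$ be its Kleene star, whose entry $(v,t)$ evaluates to the length of a shortest path from $v$ to $t$. Let $B\subseteq\mathbb R^k$ be the feasible domain, consisting of all $x$ with $\lambda_{uv}\le x_{uv}\le\mu_{uv}$ for each variable $x_{uv}$. Fix a target node $t$. A feasible region induced by the shortest paths to $t$ is a $k$-dimensional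 set of the form $$\{x\in B : \text{for each node } v \text{ with } D^*_{vt}\neq\infty, \text{ the term } \tau_v \text{ attains the minimum in } D^*_{vt} \text{ at } x\},$$ where $\tau_v$ is a term of the tropical polynomial $D^*_{vt}$ for each such $v$; that is, it is a maximal cell of the common refinement, on $B$, of the polyhedral subdivisions defined by the entries in column $t$ of $D^*$. Then the number of feasible regions induced by the shortest paths to $t$ is finite and at most $$\sum_{i=0}^k\binom ki\frac{(n-1)!}{(n-i-1)!}\ \le\ \sum_{i=0}^k\binom ki (n-1)^i\ =\ n^k,$$ where $\frac{(n-1)!}{(n-i-1)!}$ stands for $(n-1)(n-2)\cdots(n-i)$, which is $0$ for $i\ge n$. -/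

import Mathlib

open scoped BigOperators

noncomputable section

/-- The tropical semiring `ℝ ∪ {∞}` with `min` as addition and `+` as multiplication;
its zero is `∞` and its one is the real number `0`. -/
abbrev TropicalReal : Type := Tropical (WithTop ℝ)

/-- A directed graph on the nodes `0, …, n-1` without parallel arcs, whose arc `(u, v)` carries
the weight interval `[lo u v, hi u v]` with `0 ≤ lo u v ≤ hi u v ≤ ∞`.
`lo u v = hi u v = ∞` says that the arc `(u, v)` is absent, `lo u v = hi u v < ∞` that its weight
is constant, and `lo u v < hi u v` that its weight is a variable. -/
structure ParamDigraph (n : ℕ) where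
  lo : Fin n → Fin n → WithTop ℝ
  hi : Fin n → Fin n → WithTop ℝ
  lo_nonneg : ∀ u v, 0 ≤ lo u v
  lo_le_hi : ∀ u v, lo u v ≤ hi u v

namespace ParamDigraph

variable {n : ℕ} (G : ParamDigraph n)

/-- The arcs of variable weight; they index the variables. -/
abbrev VarArc : Type := {e : Fin n × Fin n // G.lo e.1 e.2 < G.hi e.1 e.2}

/-- The number `k` of variables. -/
def numVars : ℕ := Nat.card G.VarArc

open Classical in
/-- The weighted adjacency matrix, with tropical polynomials as its entries: a variable of its own
for each arc of variable weight, and a constant (possibly `∞`) everywhere else. -/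
def adjMatrix : Matrix (Fin n) (Fin n) (MvPolynomial G.VarArc TropicalReal) :=
  fun u v =>
    if h : G.lo u v < G.hi u v then MvPolynomial.X ⟨(u, v), h⟩
    else MvPolynomial.C (Tropical.trop (G.lo u v))

/-- The Kleene star `D* = (I ⊕ D)^(n-1) = I ⊕ D ⊕ ⋯ ⊕ D^(n-1)` of the weighted adjacency matrix.
There are no negative cycles, so the entry `(u, v)` evaluates to the length of a shortest path
from `u` to `v`. -/
def kleeneStar : Matrix (Fin n) (Fin n) (MvPolynomial G.VarArc TropicalReal) :=
  (1 + G.adjMatrix) ^ (n - 1)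

/-- The feasible domain: the product of the weight intervals of the variables. -/
def feasibleDomain : Set (G.VarArc → ℝ) :=
  {x | ∀ e : G.VarArc, G.lo e.1.1 e.1.2 ≤ (x e : WithTop ℝ) ∧ (x e : WithTop ℝ) ≤ G.hi e.1.1 e.1.2}

end ParamDigraph

/-- The evaluation function of a tropical polynomial `f`: the value at `x` is the minimum of the
numbers `γ_a + ∑ i, a_i * x_i` over all terms of `f`, and `∞` if `f` has no terms. -/
def tropEval {σ : Type*} (f : MvPolynomial σ TropicalReal) (x : σ → ℝ) : WithTop ℝ :=
  Tropical.untrop (MvPolynomial.eval (fun i => Tropical.trop (x i : WithTop ℝ)) f)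

/-- The polyhedron of all `x` at which the term of `f` with exponent `a` attains the minimum. -/
def termCell {σ : Type*} (f : MvPolynomial σ TropicalReal) (a : σ →₀ ℕ) : Set (σ → ℝ) :=
  {x | tropEval f x = tropEval (MvPolynomial.monomial a (f.coeff a)) x}

namespace ParamDigraph

variable {n : ℕ} (G : ParamDigraph n)

/-- The feasible regions induced by the shortest paths to `t`: the cells of full dimension of the
decomposition of the feasible domain that is the common refinement of the subdivisions defined by
the finite entries in column `t` of the Kleene star. Such a cell is obtained by choosing one term
of each of these entries. A polyhedron has full dimension iff its interior is nonempty. -/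
def feasibleRegions (t : Fin n) : Set (Set (G.VarArc → ℝ)) :=
  {R | (∃ a : Fin n → (G.VarArc →₀ ℕ),
          (∀ v, G.kleeneStar v t ≠ 0 → a v ∈ (G.kleeneStar v t).support) ∧
          R = G.feasibleDomain ∩
            ⋂ v ∈ {v : Fin n | G.kleeneStar v t ≠ 0}, termCell (G.kleeneStar v t) (a v)) ∧
        (interior R).Nonempty}

end ParamDigraph

end

/-! Fix a point `x` inside a region. For every node `v ≠ t` record the first variable arc `o v` on a
shortest path to `t` at `x`, or `none` if there is no such arc or no path. The multiset of these `n
- 1` records determines the region, so there are at most `(n - 1 + k).choose (n - 1)` regions, and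
Vandermonde's identity yields the stated sum.

If `g v` is the constant cost of getting to the arc, then at every feasible `y` the distance of `v`
is at most `g v` plus the cost of continuing through `o v`, with equality at `x`
(`exists_isFirstArc`). Summed over `v ≠ t`, the continuation costs depend only on the multiset. If
`(o, g)` at `x` and `(o', g')` at `x'` share it, comparing sums at `x` gives `∑ g ≤ ∑ g'`, and at
`x'` the converse; so `(o', g')` is tight at `x` too (`IsFirstArc.tight_of_map_eq`). Affine
functions touching at an interior point have equal gradients, so in both regions the exponent of `v`
is that of the head of `o' v` plus one unit for the arc. Unwinding this recursion, the exponents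
agree (`IsChart.exponent_unique`), and they define the region. -/

/-! ### Shortest walks and the Bellman inequality -/

section Bellman

open Tropical (trop untrop untrop_trop untrop_add untrop_mul untrop_pow untrop_zero trop_untrop)

variable {V : Type*} [Fintype V] [DecidableEq V]

/-- The least weight of a walk with at most `m` arcs from `v` to `t`. -/
noncomputable def walkDist (w : V → V → WithTop ℝ) (t : V) (m : ℕ) (v : V) : WithTop ℝ :=
  untrop (((1 + Matrix.of fun a b => trop (w a b)) ^ m : Matrix V V TropicalReal) v t)

theorem walkDist_zero (w : V → V → WithTop ℝ) (t v : V) :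
    walkDist w t 0 v = if v = t then 0 else ⊤ := by
  unfold walkDist
  rw [pow_zero, Matrix.one_apply]
  split_ifs <;> rfl

theorem walkDist_succ (w : V → V → WithTop ℝ) (t : V) (m : ℕ) (v : V) :
    walkDist w t (m + 1) v =
      min (walkDist w t m v) (Finset.univ.inf fun u => w v u + walkDist w t m u) := by
  unfold walkDist
  rw [pow_succ', add_mul, one_mul, Matrix.add_apply, untrop_add, Matrix.mul_apply,
    Finset.untrop_sum']
  rfl

theorem walkDist_antitone (w : V → V → WithTop ℝ) (t v : V) :
    Antitone fun m => walkDist w t m v :=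
  antitone_nat_of_succ_le fun m => by
    rw [walkDist_succ]
    exact min_le_left _ _

theorem walkDist_succ_le (w : V → V → WithTop ℝ) (t : V) (m : ℕ) (v u : V) :
    walkDist w t (m + 1) v ≤ w v u + walkDist w t m u := by
  rw [walkDist_succ]
  exact (min_le_right _ _).trans (Finset.inf_le (f := fun u => w v u + walkDist w t m u)
    (Finset.mem_univ u))

theorem walkDist_succ_eq (w : V → V → WithTop ℝ) (t : V) (m : ℕ) (v : V) :
    walkDist w t (m + 1) v = walkDist w t m v ∨
      ∃ u, walkDist w t (m + 1) v = w v u + walkDist w t m u := by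
  rw [walkDist_succ]
  rcases min_choice (walkDist w t m v) (Finset.univ.inf fun u => w v u + walkDist w t m u)
    with h | h
  · exact Or.inl h
  · obtain ⟨u, -, hu⟩ := Finset.exists_mem_eq_inf Finset.univ ⟨v, Finset.mem_univ v⟩
      fun u => w v u + walkDist w t m u
    exact Or.inr ⟨u, h.trans hu⟩

theorem walkDist_nonneg {w : V → V → WithTop ℝ} (hw : ∀ u v, 0 ≤ w u v) (t : V) (m : ℕ) :
    ∀ v, 0 ≤ walkDist w t m v := by
  induction m with
  | zero =>
    intro v
    rw [walkDist_zero]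
    split_ifs
    · exact le_rfl
    · exact le_top
  | succ m ih =>
    intro v
    rw [walkDist_succ]
    exact le_min (ih v) (Finset.le_inf fun u _ => add_nonneg (hw v u) (ih u))

theorem walkDist_self {w : V → V → WithTop ℝ} (hw : ∀ u v, 0 ≤ w u v) (t : V) (m : ℕ) :
    walkDist w t m t = 0 := by
  refine le_antisymm ((walkDist_antitone w t t (Nat.zero_le m)).trans ?_)
    (walkDist_nonneg hw t m t)
  simp [walkDist_zero]

/-- There is a simple path from `v` to `t` with node set `S` and weight `c`. -/
inductive HasPath (w : V → V → WithTop ℝ) (t : V) : Finset V → V → WithTop ℝ → Prop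
  | nil : HasPath w t {t} t 0
  | cons {S : Finset V} {u : V} {c : WithTop ℝ} (v : V) (hv : v ∉ S) (h : HasPath w t S u c) :
      HasPath w t (insert v S) v (w v u + c)

omit [Fintype V] in
theorem HasPath.exists_suffix {w : V → V → WithTop ℝ} (hw : ∀ u v, 0 ≤ w u v) {t : V}
    {S : Finset V} {u : V} {c : WithTop ℝ} (h : HasPath w t S u c) {v : V} (hv : v ∈ S) :
    ∃ S' c', c' ≤ c ∧ HasPath w t S' v c' := by
  induction h with
  | nil =>
    rw [Finset.mem_singleton] at hv
    subst hv
    exact ⟨_, _, le_rfl, .nil⟩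
  | @cons S u c y hy h ih =>
    rcases Finset.mem_insert.1 hv with rfl | hv
    · exact ⟨_, _, le_rfl, .cons _ hy h⟩
    · obtain ⟨S', c', hc, h'⟩ := ih hv
      exact ⟨S', c', hc.trans (le_add_of_nonneg_left (hw _ _)), h'⟩

theorem HasPath.walkDist_le {w : V → V → WithTop ℝ} {t : V}
    {S : Finset V} {u : V} {c : WithTop ℝ} (h : HasPath w t S u c) :
    0 < S.card ∧ walkDist w t (S.card - 1) u ≤ c := by
  induction h with
  | nil => simp [walkDist_zero]
  | @cons S u c v hv h ih =>
    rw [Finset.card_insert_of_notMem hv]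
    refine ⟨Nat.succ_pos _, ?_⟩
    obtain ⟨m, hm⟩ := Nat.exists_eq_succ_of_ne_zero ih.1.ne'
    rw [hm] at ih ⊢
    exact (walkDist_succ_le w t m v u).trans (add_le_add le_rfl ih.2)

/-- Cycles can be cut out at no cost: if the new first node already lies on the path, the suffix
starting there is no heavier. -/
theorem exists_hasPath_le {w : V → V → WithTop ℝ} (hw : ∀ u v, 0 ≤ w u v) (t : V) (m : ℕ) :
    ∀ v, walkDist w t m v ≠ ⊤ → ∃ S c, c ≤ walkDist w t m v ∧ HasPath w t S v c := by
  induction m with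
  | zero =>
    intro v hv
    rw [walkDist_zero] at hv ⊢
    split_ifs at hv ⊢ with h
    · subst h
      exact ⟨_, _, le_rfl, .nil⟩
    · exact absurd rfl hv
  | succ m ih =>
    intro v hv
    rcases walkDist_succ_eq w t m v with h | ⟨u, h⟩
    · rw [h] at hv ⊢
      exact ih v hv
    · rw [h] at hv ⊢
      obtain ⟨S, c, hc, hp⟩ := ih u (WithTop.add_ne_top.1 hv).2
      by_cases hvS : v ∈ S
      · obtain ⟨S', c', hc', hp'⟩ := hp.exists_suffix hw hvS
        exact ⟨S', c', (hc'.trans hc).trans (le_add_of_nonneg_left (hw _ _)), hp'⟩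
      · exact ⟨_, _, add_le_add le_rfl hc, .cons v hvS hp⟩

/-- Without negative weights, walks with at least as many arcs as there are nodes are never
needed. -/
theorem walkDist_card_sub_one_le {w : V → V → WithTop ℝ} (hw : ∀ u v, 0 ≤ w u v) (t : V)
    (m : ℕ) (v : V) : walkDist w t (Fintype.card V - 1) v ≤ walkDist w t m v := by
  by_cases h : walkDist w t m v = ⊤
  · rw [h]
    exact le_top
  · obtain ⟨S, c, hc, hp⟩ := exists_hasPath_le hw t m v h
    exact ((walkDist_antitone w t v (Nat.sub_le_sub_right S.card_le_univ 1)).trans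
      hp.walkDist_le.2).trans hc

theorem walkDist_card_sub_one_le_add {w : V → V → WithTop ℝ} (hw : ∀ u v, 0 ≤ w u v) (t v u : V) :
    walkDist w t (Fintype.card V - 1) v ≤ w v u + walkDist w t (Fintype.card V - 1) u :=
  (walkDist_card_sub_one_le hw t _ v).trans (walkDist_succ_le w t _ v u)

end Bellman

theorem coe_untopD_of_ne_top {c : WithTop ℝ} (h : c ≠ ⊤) : ((c.untopD 0 : ℝ) : WithTop ℝ) = c := by
  lift c to ℝ using h
  rfl

/-! ### Terms of tropical polynomials as affine functions -/

section LinearForms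

open Tropical (trop untrop untrop_trop untrop_add untrop_mul untrop_pow untrop_zero trop_untrop)

variable {σ : Type*}

/-- The linear form with natural coefficients `a`. -/
noncomputable def expForm (a : σ →₀ ℕ) (x : σ → ℝ) : ℝ := a.sum fun i m => (m : ℝ) * x i

@[simp]
theorem expForm_zero (x : σ → ℝ) : expForm 0 x = 0 := Finsupp.sum_zero_index

theorem expForm_add (a b : σ →₀ ℕ) (x : σ → ℝ) :
    expForm (a + b) x = expForm a x + expForm b x :=
  Finsupp.sum_add_index' (by simp) (by intros; push_cast; ring)

@[simp]
theorem expForm_single (i : σ) (x : σ → ℝ) : expForm (Finsupp.single i 1) x = x i := by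
  simp [expForm]

theorem expForm_add_single [DecidableEq σ] (a : σ →₀ ℕ) (x : σ → ℝ) (i : σ) (s : ℝ) :
    expForm a (x + Pi.single i s) = expForm a x + a i * s := by
  unfold expForm Finsupp.sum
  simp only [Pi.add_apply, mul_add, Finset.sum_add_distrib]
  congr 1
  rw [Finset.sum_eq_single i]
  · simp
  · intro j _ hj
    simp [hj]
  · intro hi
    simp [Finsupp.notMem_support_iff.1 hi]

/-- Two affine functions that touch at an interior point have the same gradient. -/
theorem exponent_eq_of_touch {U : Set (σ → ℝ)} (hU : IsOpen U) {x : σ → ℝ} (hx : x ∈ U)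
    {a b : σ →₀ ℕ} {α β : ℝ} (hle : ∀ y ∈ U, α + expForm a y ≤ β + expForm b y)
    (heq : α + expForm a x = β + expForm b x) : a = b := by
  classical
  ext i
  have hcont : Continuous fun s : ℝ => x + Pi.single i s := by
    refine continuous_const.add (continuous_pi fun j => ?_)
    by_cases h : j = i
    · subst h
      simpa using continuous_id'
    · simpa [h] using continuous_const
  have hmem : (fun s : ℝ => x + Pi.single i s) ⁻¹' U ∈ nhds (0 : ℝ) :=
    (hU.preimage hcont).mem_nhds (by simpa using hx)
  obtain ⟨ε, hε, hball⟩ := Metric.mem_nhds_iff.1 hmem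
  -- Along axis `i` the gap between the two sides is linear in `s`; having one sign on both sides of
  -- `0`, it has slope zero.
  have key : ∀ s : ℝ, |s| < ε → (a i : ℝ) * s ≤ b i * s := by
    intro s hs
    have := hle _ (hball (by simpa using hs : s ∈ Metric.ball (0 : ℝ) ε))
    rw [expForm_add_single, expForm_add_single] at this
    linarith
  have h1 := key (ε / 2) (by rw [abs_of_pos (by linarith)]; linarith)
  have h2 := key (-(ε / 2)) (by rw [abs_neg, abs_of_pos (by linarith)]; linarith)
  have h3 : (a i : ℝ) * (ε / 2) = b i * (ε / 2) := by linarith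
  exact_mod_cast mul_right_cancel₀ (by linarith : ε / 2 ≠ 0) h3

theorem tropEval_monomial (a : σ →₀ ℕ) (c : TropicalReal) (x : σ → ℝ) :
    tropEval (MvPolynomial.monomial a c) x = untrop c + (expForm a x : WithTop ℝ) := by
  unfold tropEval expForm Finsupp.sum
  rw [MvPolynomial.eval_monomial, untrop_mul]
  congr 1
  rw [Finsupp.prod, untrop_prod]
  simp only [untrop_pow, untrop_trop]
  rw [WithTop.coe_sum]
  refine Finset.sum_congr rfl fun i _ => ?_
  rw [← WithTop.coe_nsmul, nsmul_eq_mul]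

theorem tropEval_ne_top {f : MvPolynomial σ TropicalReal} (hf : f ≠ 0) (x : σ → ℝ) :
    tropEval f x ≠ ⊤ := by
  obtain ⟨a, ha⟩ := MvPolynomial.support_nonempty.2 hf
  have hle : tropEval f x ≤ tropEval (MvPolynomial.monomial a (f.coeff a)) x := by
    unfold tropEval
    rw [MvPolynomial.eval_monomial, MvPolynomial.eval_eq, Finset.untrop_sum']
    exact Finset.inf_le ha
  refine ne_top_of_le_ne_top ?_ hle
  rw [tropEval_monomial]
  refine WithTop.add_ne_top.2 ⟨fun h => MvPolynomial.mem_support_iff.1 ha ?_, WithTop.coe_ne_top⟩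
  rw [← trop_untrop (f.coeff a), h]
  rfl

end LinearForms

/-! ### Distances to the target -/

namespace ParamDigraph

open Tropical (trop untrop untrop_trop untrop_add untrop_mul untrop_pow untrop_zero trop_untrop)

variable {n : ℕ} (G : ParamDigraph n)

open Classical in
/-- The weight of the pair `(u, v)` at the parameters `x`. -/
noncomputable def weight (x : G.VarArc → ℝ) (u v : Fin n) : WithTop ℝ :=
  if h : G.lo u v < G.hi u v then (x ⟨(u, v), h⟩ : WithTop ℝ) else G.lo u v

theorem weight_varArc (x : G.VarArc → ℝ) (e : G.VarArc) :
    G.weight x e.1.1 e.1.2 = (x e : WithTop ℝ) :=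
  dif_pos e.2

theorem weight_of_not_lt (x : G.VarArc → ℝ) {u v : Fin n} (h : ¬ G.lo u v < G.hi u v) :
    G.weight x u v = G.lo u v :=
  dif_neg h

theorem weight_nonneg {x : G.VarArc → ℝ} (hx : x ∈ G.feasibleDomain) (u v : Fin n) :
    0 ≤ G.weight x u v := by
  unfold weight
  split_ifs with h
  · exact (G.lo_nonneg u v).trans (hx ⟨(u, v), h⟩).1
  · exact G.lo_nonneg u v

/-- The length of a shortest path from `v` to `t` at the parameters `x`. -/
noncomputable def dist (t : Fin n) (x : G.VarArc → ℝ) (v : Fin n) : WithTop ℝ :=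
  tropEval (G.kleeneStar v t) x

theorem dist_eq_walkDist (t : Fin n) (x : G.VarArc → ℝ) (v : Fin n) :
    G.dist t x v = walkDist (G.weight x) t (Fintype.card (Fin n) - 1) v := by
  unfold dist tropEval walkDist kleeneStar
  rw [Fintype.card_fin]
  set φ := MvPolynomial.eval (fun i => trop (x i : WithTop ℝ)) with hφ
  have h : φ.mapMatrix ((1 + G.adjMatrix) ^ (n - 1)) =
      (1 + Matrix.of fun a b => trop (G.weight x a b)) ^ (n - 1) := by
    rw [map_pow, map_add, map_one]
    congr 2
    ext a b
    simp only [RingHom.mapMatrix_apply, Matrix.map_apply, Matrix.of_apply, adjMatrix, weight]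
    split_ifs <;> simp [hφ]
  rw [← h]
  rfl

theorem dist_self {x : G.VarArc → ℝ} (hx : x ∈ G.feasibleDomain) (t : Fin n) :
    G.dist t x t = 0 := by
  rw [dist_eq_walkDist]
  exact walkDist_self (G.weight_nonneg hx) t _

theorem dist_le_weight_add {x : G.VarArc → ℝ} (hx : x ∈ G.feasibleDomain) (t v u : Fin n) :
    G.dist t x v ≤ G.weight x v u + G.dist t x u := by
  rw [dist_eq_walkDist, dist_eq_walkDist]
  exact walkDist_card_sub_one_le_add (G.weight_nonneg hx) t v u

theorem kleeneStar_ne_zero_of_dist_ne_top {t v : Fin n} {x : G.VarArc → ℝ}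
    (h : G.dist t x v ≠ ⊤) : G.kleeneStar v t ≠ 0 := by
  intro h0
  apply h
  unfold dist tropEval
  rw [h0, map_zero, untrop_zero]

/-! ### First variable arcs -/

/-- The length of a shortest path to `t` that starts with the given variable arc; `0` if there is
none. -/
noncomputable def distVia (t : Fin n) (x : G.VarArc → ℝ) : Option G.VarArc → WithTop ℝ
  | none => 0
  | some e => (x e : WithTop ℝ) + G.dist t x e.1.2

/-- Along a shortest path from `v` to `t` at `x`, the first variable arc `o` is reached at a
constant cost `g`. -/
theorem exists_firstArc {x : G.VarArc → ℝ} (hx : x ∈ G.feasibleDomain) (t v : Fin n) :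
    ∃ (o : Option G.VarArc) (g : WithTop ℝ), G.dist t x v = g + G.distVia t x o ∧
      ∀ y ∈ G.feasibleDomain, G.dist t y v ≤ g + G.distVia t y o := by
  have key : ∀ m v, ∃ (o : Option G.VarArc) (g : WithTop ℝ),
      g + G.distVia t x o ≤ walkDist (G.weight x) t m v ∧
      ∀ y ∈ G.feasibleDomain, G.dist t y v ≤ g + G.distVia t y o := by
    intro m
    induction m with
    | zero =>
      intro v
      rw [walkDist_zero]
      split_ifs with h
      · subst h
        exact ⟨none, 0, by simp [distVia], fun y hy => by simp [G.dist_self hy, distVia]⟩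
      · exact ⟨none, ⊤, le_top, fun y _ => by simp⟩
    | succ m ih =>
      intro v
      rcases walkDist_succ_eq (G.weight x) t m v with h | ⟨u, h⟩
      · rw [h]
        exact ih v
      · rw [h]
        by_cases hvu : G.lo v u < G.hi v u
        -- The first arc is itself variable, so nothing constant precedes it; what follows is
        -- replaced by a shortest path from `u`.
        · refine ⟨some ⟨(v, u), hvu⟩, 0, ?_, fun y hy => ?_⟩
          · rw [zero_add, G.weight_varArc x ⟨(v, u), hvu⟩]
            refine add_le_add le_rfl ?_
            rw [dist_eq_walkDist]
            exact walkDist_card_sub_one_le (G.weight_nonneg hx) t m u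
          · rw [zero_add]
            have := G.dist_le_weight_add hy t v u
            rwa [G.weight_varArc y ⟨(v, u), hvu⟩] at this
        · obtain ⟨o, g, h1, h2⟩ := ih u
          refine ⟨o, G.lo v u + g, ?_, fun y hy => ?_⟩
          · rw [G.weight_of_not_lt x hvu, add_assoc]
            exact add_le_add le_rfl h1
          · have := G.dist_le_weight_add hy t v u
            rw [G.weight_of_not_lt y hvu] at this
            rw [add_assoc]
            exact this.trans (add_le_add le_rfl (h2 y hy))
  obtain ⟨o, g, h1, h2⟩ := key (Fintype.card (Fin n) - 1) v
  rw [← dist_eq_walkDist] at h1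
  exact ⟨o, g, le_antisymm (h2 x hx) h1, h2⟩

/-- The real value of `dist`, with `0` in place of `∞`. -/
noncomputable def realDist (t : Fin n) (x : G.VarArc → ℝ) (v : Fin n) : ℝ :=
  (G.dist t x v).untopD 0

/-- The real value of `distVia`, with `0` in place of an infinite distance. -/
noncomputable def realVia (t : Fin n) (x : G.VarArc → ℝ) : Option G.VarArc → ℝ
  | none => 0
  | some e => x e + G.realDist t x e.1.2

theorem coe_realDist {t v : Fin n} (h : G.kleeneStar v t ≠ 0) (x : G.VarArc → ℝ) :
    (G.realDist t x v : WithTop ℝ) = G.dist t x v :=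
  coe_untopD_of_ne_top (tropEval_ne_top h x)

theorem dist_eq_top {t v : Fin n} (h : G.kleeneStar v t = 0) (x : G.VarArc → ℝ) :
    G.dist t x v = ⊤ := by
  by_contra h'
  exact G.kleeneStar_ne_zero_of_dist_ne_top h' h

theorem realDist_eq_zero {t v : Fin n} (h : G.kleeneStar v t = 0) (x : G.VarArc → ℝ) :
    G.realDist t x v = 0 := by
  rw [realDist, G.dist_eq_top h]
  rfl

theorem realDist_self {x : G.VarArc → ℝ} (hx : x ∈ G.feasibleDomain) (t : Fin n) :
    G.realDist t x t = 0 := by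
  rw [realDist, G.dist_self hx]
  rfl

/-- Each node `v` that reaches `t` reaches the variable arc `o v`, or `t` if there is none, along
a path of constant weight `g v`. -/
structure IsFirstArc (t : Fin n) (o : Fin n → Option G.VarArc) (g : Fin n → ℝ) : Prop where
  target : o t = none
  reach : ∀ v e, o v = some e → G.kleeneStar v t ≠ 0 ∧ G.kleeneStar e.1.2 t ≠ 0
  le : ∀ y ∈ G.feasibleDomain, ∀ v, G.realDist t y v ≤ g v + G.realVia t y (o v)

theorem exists_isFirstArc {x : G.VarArc → ℝ} (hx : x ∈ G.feasibleDomain) (t : Fin n) :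
    ∃ o g, G.IsFirstArc t o g ∧ ∀ v, G.realDist t x v = g v + G.realVia t x (o v) := by
  have key : ∀ v, ∃ (o : Option G.VarArc) (g : ℝ), (v = t → o = none) ∧
      (∀ e, o = some e → G.kleeneStar v t ≠ 0 ∧ G.kleeneStar e.1.2 t ≠ 0) ∧
      (∀ y ∈ G.feasibleDomain, G.realDist t y v ≤ g + G.realVia t y o) ∧
      G.realDist t x v = g + G.realVia t x o := by
    intro v
    by_cases hvt : v = t
    · subst hvt
      refine ⟨none, 0, fun _ => rfl, by simp, fun y hy => ?_, ?_⟩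
      · simp [G.realDist_self hy, realVia]
      · simp [G.realDist_self hx, realVia]
    by_cases h0 : G.kleeneStar v t = 0
    -- With the default distance `0`, a node that cannot reach `t` satisfies its inequality with
    -- equality and does not disturb the sums.
    · exact ⟨none, 0, fun _ => rfl, by simp, fun y _ => by simp [G.realDist_eq_zero h0, realVia],
        by simp [G.realDist_eq_zero h0, realVia]⟩
    obtain ⟨o, g, heq, hle⟩ := G.exists_firstArc hx t v
    have hfin : g + G.distVia t x o ≠ ⊤ := heq ▸ tropEval_ne_top h0 x
    rw [WithTop.add_ne_top] at hfin
    lift g to ℝ using hfin.1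
    have hreach : ∀ e, o = some e → G.kleeneStar e.1.2 t ≠ 0 := by
      rintro e rfl
      exact G.kleeneStar_ne_zero_of_dist_ne_top (WithTop.add_ne_top.1 hfin.2).2
    have hvia : ∀ y, G.distVia t y o = (G.realVia t y o : WithTop ℝ) := by
      intro y
      cases o with
      | none => rfl
      | some e =>
        change _ + _ = ((y e + G.realDist t y e.1.2 : ℝ) : WithTop ℝ)
        rw [WithTop.coe_add, G.coe_realDist (hreach e rfl)]
    refine ⟨o, g, fun h => absurd h hvt, fun e he => ⟨h0, hreach e he⟩, fun y hy => ?_, ?_⟩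
    · have := hle y hy
      rw [hvia, ← G.coe_realDist h0] at this
      exact_mod_cast this
    · rw [hvia, ← G.coe_realDist h0] at heq
      exact_mod_cast heq
  choose o g h1 h2 h3 h4 using key
  exact ⟨o, g, ⟨h1 t rfl, h2, fun y hy v => h3 v y hy⟩, h4⟩

/-! ### Exponents are determined by the first arcs -/

/-- On the open set `U` of feasible points, the finite distances to `t` are affine, with exponents
`a` and constant terms `γ`. -/
structure IsChart (t : Fin n) (U : Set (G.VarArc → ℝ)) (a : Fin n → G.VarArc →₀ ℕ)
    (γ : Fin n → ℝ) : Prop where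
  isOpen : IsOpen U
  subset : U ⊆ G.feasibleDomain
  realDist_eq : ∀ x ∈ U, ∀ v, G.kleeneStar v t ≠ 0 → G.realDist t x v = γ v + expForm (a v) x

/-- Where the path through `o v` is a shortest one, the exponent of `v` is obtained from that of the
head of `o v`. -/
theorem IsChart.exponent_eq {t : Fin n} {U : Set (G.VarArc → ℝ)} {a : Fin n → G.VarArc →₀ ℕ}
    {γ : Fin n → ℝ} (hU : G.IsChart t U a γ) {o : Fin n → Option G.VarArc} {g : Fin n → ℝ}
    (ho : G.IsFirstArc t o g) {x : G.VarArc → ℝ} (hx : x ∈ U) {v : Fin n}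
    (hv : G.kleeneStar v t ≠ 0) (htight : G.realDist t x v = g v + G.realVia t x (o v)) :
    a v = (o v).elim 0 fun e => a e.1.2 + Finsupp.single e 1 := by
  have hle := fun y (hy : y ∈ U) => ho.le y (hU.subset hy) v
  cases h : o v with
  | none =>
    simp only [h, realVia, add_zero] at hle htight
    refine exponent_eq_of_touch hU.isOpen hx (α := γ v) (β := g v) (fun y hy => ?_) ?_
    · simpa [← hU.realDist_eq y hy v hv] using hle y hy
    · simpa [← hU.realDist_eq x hx v hv] using htight
  | some e =>
    have he := (ho.reach v e h).2
    simp only [h, realVia] at hle htight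
    have hrw : ∀ y ∈ U, g v + γ e.1.2 + expForm (a e.1.2 + Finsupp.single e 1) y =
        g v + (y e + G.realDist t y e.1.2) := by
      intro y hy
      rw [hU.realDist_eq y hy _ he, expForm_add, expForm_single]
      ring
    refine exponent_eq_of_touch hU.isOpen hx (α := γ v) (β := g v + γ e.1.2) (fun y hy => ?_) ?_
    · simp only [Option.elim_some]
      rw [hrw y hy, ← hU.realDist_eq y hy v hv]
      exact hle y hy
    · simp only [Option.elim_some]
      rw [hrw x hx, ← hU.realDist_eq x hx v hv]
      exact htight

/-- Two choices of first arcs that use each arc equally often are both optimal wherever one of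
them is. -/
theorem IsFirstArc.tight_of_map_eq {t : Fin n} {o o' : Fin n → Option G.VarArc} {g g' : Fin n → ℝ}
    (ho : G.IsFirstArc t o g) (ho' : G.IsFirstArc t o' g')
    (hmap : (Finset.univ.erase t).val.map o = (Finset.univ.erase t).val.map o')
    {x x' : G.VarArc → ℝ} (hx : x ∈ G.feasibleDomain) (hx' : x' ∈ G.feasibleDomain)
    (htight : ∀ v, G.realDist t x v = g v + G.realVia t x (o v))
    (htight' : ∀ v, G.realDist t x' v = g' v + G.realVia t x' (o' v))
    {v : Fin n} (hv : v ≠ t) : G.realDist t x v = g' v + G.realVia t x (o' v) := by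
  have hsum : ∀ y, ∑ v ∈ Finset.univ.erase t, G.realVia t y (o v) =
      ∑ v ∈ Finset.univ.erase t, G.realVia t y (o' v) := by
    intro y
    have := congrArg (fun s => (s.map (G.realVia t y)).sum) hmap
    rwa [Multiset.map_map, Multiset.map_map] at this
  have h1 := Finset.sum_le_sum fun v (_ : v ∈ Finset.univ.erase t) => ho'.le x hx v
  have h2 := Finset.sum_le_sum fun v (_ : v ∈ Finset.univ.erase t) => ho.le x' hx' v
  have h3 := Finset.sum_congr (rfl : Finset.univ.erase t = _) fun v _ => htight v
  have h4 := Finset.sum_congr (rfl : Finset.univ.erase t = _) fun v _ => htight' v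
  rw [Finset.sum_add_distrib] at h1 h2 h3 h4
  have h5 := hsum x
  have h6 := hsum x'
  -- Termwise inequalities whose sums agree are equalities; the sums agree because `∑ g = ∑ g'`.
  refine (Finset.sum_eq_sum_iff_of_le fun v _ => ho'.le x hx v).1 ?_ v
    (Finset.mem_erase.2 ⟨hv, Finset.mem_univ v⟩)
  rw [Finset.sum_add_distrib]
  linarith

theorem kleeneStar_self_ne_zero {x : G.VarArc → ℝ} (hx : x ∈ G.feasibleDomain) (t : Fin n) :
    G.kleeneStar t t ≠ 0 :=
  G.kleeneStar_ne_zero_of_dist_ne_top (by rw [G.dist_self hx]; exact WithTop.zero_ne_top)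

theorem IsChart.exponent_target {t : Fin n} {U : Set (G.VarArc → ℝ)} {a : Fin n → G.VarArc →₀ ℕ}
    {γ : Fin n → ℝ} (hU : G.IsChart t U a γ) {x : G.VarArc → ℝ} (hx : x ∈ U) : a t = 0 := by
  have h0 := G.kleeneStar_self_ne_zero (hU.subset hx) t
  have h : ∀ y ∈ U, γ t + expForm (a t) y = 0 + expForm 0 y := fun y hy => by
    rw [← hU.realDist_eq y hy t h0, G.realDist_self (hU.subset hy), expForm_zero, add_zero]
  exact exponent_eq_of_touch hU.isOpen hx (fun y hy => (h y hy).le) (h x hx)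

/-- The multiset of first variable arcs determines the exponents. -/
theorem IsChart.exponent_unique {t : Fin n} {U U' : Set (G.VarArc → ℝ)}
    {a a' : Fin n → G.VarArc →₀ ℕ} {γ γ' : Fin n → ℝ} (hU : G.IsChart t U a γ)
    (hU' : G.IsChart t U' a' γ') {o o' : Fin n → Option G.VarArc} {g g' : Fin n → ℝ}
    (ho : G.IsFirstArc t o g) (ho' : G.IsFirstArc t o' g')
    (hmap : (Finset.univ.erase t).val.map o = (Finset.univ.erase t).val.map o')
    {x x' : G.VarArc → ℝ} (hx : x ∈ U) (hx' : x' ∈ U')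
    (htight : ∀ v, G.realDist t x v = g v + G.realVia t x (o v))
    (htight' : ∀ v, G.realDist t x' v = g' v + G.realVia t x' (o' v)) :
    ∀ v, G.kleeneStar v t ≠ 0 → a v = a' v := by
  -- Passing from `v` to the head of `o' v` lowers the degree of the exponent by one, so the
  -- recursion ends.
  suffices H : ∀ N v, (a' v).degree = N → G.kleeneStar v t ≠ 0 → a v = a' v from
    fun v => H _ v rfl
  intro N
  induction N using Nat.strong_induction_on with
  | _ N ih =>
    intro v hN hv
    by_cases hvt : v = t
    · subst hvt
      rw [hU.exponent_target G hx, hU'.exponent_target G hx']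
    have h := hU.exponent_eq G ho' hx hv (ho.tight_of_map_eq G ho' hmap (hU.subset hx)
      (hU'.subset hx') htight htight' hvt)
    have h' := hU'.exponent_eq G ho' hx' hv (htight' v)
    cases hov : o' v with
    | none => rw [h, h', hov]; rfl
    | some e =>
      rw [hov] at h h'
      simp only [Option.elim_some] at h h'
      rw [h, h', ih _ ?_ e.1.2 rfl (ho'.reach v e hov).2]
      rw [← hN, h', map_add, Finsupp.degree_single]
      exact Nat.lt_succ_self _

/-! ### Encoding regions by multisets -/

/-- The multiset `s` of first variable arcs, one for each node other than `t`, occurs in the region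
`R`. -/
def IsCode (t : Fin n) (R : Set (G.VarArc → ℝ)) (s : Multiset (Option G.VarArc)) : Prop :=
  ∃ (a : Fin n → G.VarArc →₀ ℕ) (γ : Fin n → ℝ) (U : Set (G.VarArc → ℝ)) (x : G.VarArc → ℝ)
    (o : Fin n → Option G.VarArc) (g : Fin n → ℝ),
    R = G.feasibleDomain ∩
      ⋂ v ∈ {v : Fin n | G.kleeneStar v t ≠ 0}, termCell (G.kleeneStar v t) (a v) ∧
    G.IsChart t U a γ ∧ x ∈ U ∧ G.IsFirstArc t o g ∧
    (∀ v, G.realDist t x v = g v + G.realVia t x (o v)) ∧ s = (Finset.univ.erase t).val.map o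

theorem IsCode.eq {t : Fin n} {R R' : Set (G.VarArc → ℝ)} {s : Multiset (Option G.VarArc)}
    (h : G.IsCode t R s) (h' : G.IsCode t R' s) : R = R' := by
  obtain ⟨a, γ, U, x, o, g, rfl, hU, hx, ho, ht, hs⟩ := h
  obtain ⟨a', γ', U', x', o', g', rfl, hU', hx', ho', ht', hs'⟩ := h'
  have := hU.exponent_unique G hU' ho ho' (hs.symm.trans hs') hx hx' ht ht'
  congr 1
  exact Set.iInter₂_congr fun v hv => by rw [this v hv]

theorem exists_isCode {t : Fin n} {R : Set (G.VarArc → ℝ)} (hR : R ∈ G.feasibleRegions t) :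
    ∃ s : Sym (Option G.VarArc) (n - 1), G.IsCode t R s.1 := by
  obtain ⟨⟨a, ha, hRa⟩, x, hx⟩ := hR
  have hsub : interior R ⊆ G.feasibleDomain := fun y hy => by
    have := interior_subset hy
    rw [hRa] at this
    exact this.1
  obtain ⟨o, g, ho, ht⟩ := G.exists_isFirstArc (hsub hx) t
  refine ⟨⟨(Finset.univ.erase t).val.map o, by simp⟩, a,
    -- On the interior of the region the chosen terms realise the distances, so their coefficients
    -- are the constant terms.
    fun v => (untrop ((G.kleeneStar v t).coeff (a v))).untopD 0, interior R, x, o, g, hRa,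
    ⟨isOpen_interior, hsub, fun y hy v hv => ?_⟩, hx, ho, ht, rfl⟩
  have hcell : y ∈ termCell (G.kleeneStar v t) (a v) := by
    have := interior_subset hy
    rw [hRa] at this
    exact Set.mem_iInter₂.1 this.2 v hv
  have hcoeff : untrop ((G.kleeneStar v t).coeff (a v)) ≠ ⊤ := fun h =>
    MvPolynomial.mem_support_iff.1 (ha v hv) (by rw [← trop_untrop (MvPolynomial.coeff _ _), h]; rfl)
  have heq : G.dist t y v = _ := hcell.trans (tropEval_monomial _ _ _)
  rw [← G.coe_realDist hv, ← coe_untopD_of_ne_top hcoeff] at heq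
  exact_mod_cast heq

theorem finite_feasibleRegions (t : Fin n) : (G.feasibleRegions t).Finite ∧
    (G.feasibleRegions t).ncard ≤ (n - 1 + G.numVars).choose (n - 1) := by
  classical
  have : Fintype G.VarArc := Fintype.ofFinite _
  choose Φ hΦ using fun R : G.feasibleRegions t => G.exists_isCode R.2
  have hinj : Function.Injective Φ := fun R R' h =>
    Subtype.ext ((hΦ R).eq G (h ▸ hΦ R'))
  refine ⟨Set.finite_coe_iff.1 (Finite.of_injective Φ hinj), ?_⟩
  have hcard := Nat.card_le_card_of_injective Φ hinj
  rw [Nat.card_coe_set_eq, Nat.card_eq_fintype_card (α := Sym _ _), Sym.card_sym_eq_choose,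
    Fintype.card_option] at hcard
  rw [numVars, Nat.card_eq_fintype_card]
  convert hcard using 2
  omega

end ParamDigraph

/-- Vandermonde gives `∑ k.choose i * m.choose i`, and dropping the division by `i!` only increases
each summand. -/
theorem choose_add_le_sum_descFactorial (m k : ℕ) :
    (m + k).choose m ≤ ∑ i ∈ Finset.range (k + 1), k.choose i * m.descFactorial i := by
  rw [Nat.choose_symm_add, Nat.add_choose_eq, Finset.Nat.sum_antidiagonal_eq_sum_range_succ_mk]
  refine Finset.sum_le_sum fun i hi => ?_
  rw [Nat.choose_symm (Nat.lt_succ_iff.1 (Finset.mem_range.1 hi)), mul_comm]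
  exact Nat.mul_le_mul_left _ (Nat.choose_le_descFactorial m i)

theorem mainTheorem3 (n k : ℕ) (G : ParamDigraph n) (hk : G.numVars = k) (t : Fin n) :
    (G.feasibleRegions t).Finite ∧
    (G.feasibleRegions t).ncard ≤
      ∑ i ∈ Finset.range (k + 1), k.choose i * (n - 1).descFactorial i ∧
    ∑ i ∈ Finset.range (k + 1), k.choose i * (n - 1).descFactorial i ≤
      ∑ i ∈ Finset.range (k + 1), k.choose i * (n - 1) ^ i ∧
    ∑ i ∈ Finset.range (k + 1), k.choose i * (n - 1) ^ i = n ^ k := by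
  subst hk
  obtain ⟨hfin, hcard⟩ := G.finite_feasibleRegions t
  have hn : n - 1 + 1 = n := Nat.sub_add_cancel (Fin.pos t)
  refine ⟨hfin, hcard.trans (choose_add_le_sum_descFactorial _ _), ?_, ?_⟩
  · exact Finset.sum_le_sum fun i _ => Nat.mul_le_mul_left _ (Nat.descFactorial_le_pow _ _)
  · have h := add_pow (n - 1) 1 G.numVars
    rw [hn] at h
    rw [h]
    exact Finset.sum_congr rfl fun i _ => by simp [mul_comm]
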